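/- A group $\Gamma$ is called \emph{LEF} (locally embeddable into finite groups) if for every finite subset $A \subseteq \Gamma$ there are a finite group $Q$ and an injective function $\phi : A \to Q$ such that $\phi(gh) = \phi(g)\phi(h)$ for all $g,h \in A$ with $gh \in A$. Let $X = (V,E)$ be any simple graph (the vertex set $V$ may be infinite), and let $\underline{H} = (H_v)_{v \in V}$ be a family of groups. The \emph{graph product} $P(\underline{H},X)$ is the quotient of the free product $\ast_{v \in V} H_v$ by the normal closure of the set of all elements $h^{-1}k^{-1}hk$ with $h \in H_v$, $k \in H_w$ and $v,w \in V$ adjacent in $X$. If every $H_v$ is LEF, then $P(\underline{H},X)$ is LEF. -/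

import Mathlib

/-- A function `φ` on a subset `A` of a group `Γ` with values in a group `Δ` is a partial
homomorphism if `φ (g h) = φ g * φ h` whenever `g`, `h` and `g h` all lie in `A`. -/
def IsPartialHom {Γ Δ : Type*} [Group Γ] [Group Δ] (A : Set Γ) (φ : A → Δ) : Prop :=
  ∀ (g h : A) (hgh : (g : Γ) * (h : Γ) ∈ A), φ ⟨(g : Γ) * (h : Γ), hgh⟩ = φ g * φ h

/-- A group is LEF (locally embeddable into finite groups) if every finite subset admits an
injective partial homomorphism to a finite group. Every finite group is isomorphic to one whose
underlying type is in `Type`, so the universe of `Q` is no restriction. -/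
def IsLEF (Γ : Type*) [Group Γ] : Prop :=
  ∀ A : Set Γ, A.Finite → ∃ (Q : Type) (_ : Group Q) (_ : Finite Q) (φ : A → Q),
    Function.Injective φ ∧ IsPartialHom A φ

/-- The relators `h⁻¹ k⁻¹ h k` with `h ∈ H v`, `k ∈ H w`, for `v`, `w` adjacent in `X`,
inside the free product of the groups `H v`. -/
def graphProductRels {V : Type*} (X : SimpleGraph V) (H : V → Type*) [∀ v, Group (H v)] :
    Set (Monoid.CoprodI H) :=
  {x | ∃ (v w : V), X.Adj v w ∧ ∃ (h : H v) (k : H w),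
    x = (Monoid.CoprodI.of h)⁻¹ * (Monoid.CoprodI.of k)⁻¹ *
      Monoid.CoprodI.of h * Monoid.CoprodI.of k}

/-- The graph product of the groups `H v` over the graph `X`: the quotient of their free product
by the normal closure of the relators above. -/
abbrev GraphProduct {V : Type*} (H : V → Type*) [∀ v, Group (H v)] (X : SimpleGraph V) : Type _ :=
  Monoid.CoprodI H ⧸ Subgroup.normalClosure (graphProductRels X H)

namespace GraphProduct

section

/-! The proof reduces to finite vertex groups by an ultraproduct. Local embeddings of the `H v` into
finite groups induce a homomorphism to an ultraproduct of graph products of finite groups; it is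
injective because reduced words stay reduced letter by letter and a nonempty reduced word is
nontrivial (`IsReduced.wordProd_ne_one`). LEF passes back from the factors
(`IsLEF.of_ultraproduct`).

For finite vertex groups, every element gets a coordinate in `H v` at each wall, a coset of the star
of `v`, and these coordinates determine it (`coord_injective`). Letting generators act only across a
finite set of walls gives an action in which the orbit of `1` is finite. If the set is large enough,
elements of a given finite set still carry `1` to themselves, so the permutations of this orbit
separate them (`isLEF_of_finite`). -/

theorem end_mul_apply {α : Type*} (f g : Function.End α) (x : α) : (f * g) x = f (g x) := rfl

theorem end_one_apply {α : Type*} (x : α) : (1 : Function.End α) x = x := rfl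

/-! ### Universal property and words -/

variable {V : Type*} {X : SimpleGraph V} {H : V → Type*} [∀ v, Group (H v)]

variable (X) in
/-- The canonical map of a vertex group to the graph product. -/
def of (v : V) : H v →* GraphProduct H X :=
  (QuotientGroup.mk' _).comp Monoid.CoprodI.of

theorem commute_of {v w : V} (hvw : X.Adj v w) (h : H v) (k : H w) :
    Commute (of X v h) (of X w k) := by
  have hmem : (Monoid.CoprodI.of h)⁻¹ * (Monoid.CoprodI.of k)⁻¹ *
      Monoid.CoprodI.of h * Monoid.CoprodI.of k ∈
        Subgroup.normalClosure (graphProductRels X H) :=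
    Subgroup.subset_normalClosure ⟨v, w, hvw, h, k, rfl⟩
  have h1 := (QuotientGroup.eq_one_iff _).2 hmem
  have h2 : (of X v h)⁻¹ * (of X w k)⁻¹ * of X v h * of X w k = 1 := h1
  have h3 : (of X w k * of X v h)⁻¹ * (of X v h * of X w k) = 1 := by
    rw [← h2]; group
  exact (inv_mul_eq_one.1 h3).symm

/-- The universal property of the graph product. -/
def lift {M : Type*} [Monoid M] (f : ∀ v, H v →* M)
    (hf : ∀ v w, X.Adj v w → ∀ h k, Commute (f v h) (f w k)) : GraphProduct H X →* M :=
  QuotientGroup.lift _ (Monoid.CoprodI.lift f) <| by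
    refine Subgroup.normalClosure_le_normal ?_
    rintro _ ⟨v, w, hvw, h, k, rfl⟩
    have hc := hf v w hvw h k⁻¹
    change Monoid.CoprodI.lift f _ = 1
    simp only [map_mul, ← map_inv, Monoid.CoprodI.lift_of]
    rw [mul_assoc (f v h⁻¹), ← hc.eq, ← mul_assoc, ← map_mul, mul_assoc, ← map_mul]
    simp

@[simp]
theorem lift_of {M : Type*} [Monoid M] (f : ∀ v, H v →* M)
    (hf : ∀ v w, X.Adj v w → ∀ h k, Commute (f v h) (f w k)) (v : V) (h : H v) :
    lift f hf (of X v h) = f v h :=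
  Monoid.CoprodI.lift_of f h

variable (X) in
/-- The element of the graph product represented by a word. -/
def wordProd (l : List (Σ v, H v)) : GraphProduct H X :=
  (l.map fun a => of X a.1 a.2).prod

@[simp]
theorem wordProd_nil : wordProd X ([] : List (Σ v, H v)) = 1 := rfl

@[simp]
theorem wordProd_cons (a : Σ v, H v) (l : List (Σ v, H v)) :
    wordProd X (a :: l) = of X a.1 a.2 * wordProd X l := by
  simp [wordProd]

@[simp]
theorem wordProd_append (l m : List (Σ v, H v)) :
    wordProd X (l ++ m) = wordProd X l * wordProd X m := by
  simp [wordProd]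

theorem exists_wordProd_eq (x : GraphProduct H X) : ∃ l, wordProd X l = x := by
  obtain ⟨y, rfl⟩ := QuotientGroup.mk'_surjective _ x
  induction y using Monoid.CoprodI.induction_on with
  | one => exact ⟨[], by simp⟩
  | of v h => exact ⟨[⟨v, h⟩], by simp [of]⟩
  | mul a b ha hb =>
    obtain ⟨l, hl⟩ := ha
    obtain ⟨m, hm⟩ := hb
    exact ⟨l ++ m, by rw [wordProd_append, hl, hm, map_mul]⟩

/-! ### Reduced words -/

variable (X) in
/-- Between any two occurrences of a vertex there is a vertex outside its star. -/
def IsReducedSeq (s : List V) : Prop :=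
  ∀ l₁ v l₂ l₃, s = l₁ ++ v :: (l₂ ++ v :: l₃) → ∃ w ∈ l₂, w ≠ v ∧ ¬ X.Adj v w

variable (X) in
/-- A word is reduced if it has no trivial letter and no two of its letters can be merged after
moving letters past letters of adjacent vertices. -/
def IsReduced (l : List (Σ v, H v)) : Prop :=
  (∀ a ∈ l, a.2 ≠ 1) ∧ IsReducedSeq X (l.map Sigma.fst)

theorem IsReducedSeq.of_infix {s t : List V} (ht : IsReducedSeq X t) (hst : s <:+: t) :
    IsReducedSeq X s := by
  rintro l₁ v l₂ l₃ rfl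
  obtain ⟨p, q, rfl⟩ := hst
  exact ht (p ++ l₁) v l₂ (l₃ ++ q) (by simp)

theorem IsReduced.of_infix {l m : List (Σ v, H v)} (hm : IsReduced X m) (hlm : l <:+: m) :
    IsReduced X l :=
  ⟨fun a ha => hm.1 a (hlm.subset ha), hm.2.of_infix (hlm.map _)⟩

/-- A word in the star of `v` can be split into a letter at `v` and a word in the link of `v`. -/
theorem exists_of_mul_wordProd_eq (v : V) (l : List (Σ v, H v))
    (hl : ∀ a ∈ l, a.1 = v ∨ X.Adj v a.1) :
    ∃ (h : H v) (m : List (Σ v, H v)), m.length ≤ l.length ∧ (∀ a ∈ m, X.Adj v a.1) ∧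
      wordProd X l = of X v h * wordProd X m := by
  induction l with
  | nil => exact ⟨1, [], by simp⟩
  | cons a l ih =>
    obtain ⟨h, m, hlen, hadj, heq⟩ := ih fun b hb => hl b (List.mem_cons_of_mem _ hb)
    obtain ⟨w, k⟩ := a
    rcases hl _ List.mem_cons_self with hw | hw
    · obtain rfl : w = v := hw
      exact ⟨k * h, m, by simp; omega, hadj, by simp [heq, mul_assoc]⟩
    · refine ⟨h, ⟨w, k⟩ :: m, by simpa using hlen, ?_, ?_⟩
      · intro b hb
        rcases List.mem_cons.1 hb with rfl | hb
        exacts [hw, hadj b hb]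
      · rw [wordProd_cons, wordProd_cons, heq, ← mul_assoc, ← mul_assoc,
          (commute_of hw h k).eq]

theorem commute_of_wordProd (v : V) (h : H v) (l : List (Σ v, H v))
    (hl : ∀ a ∈ l, X.Adj v a.1) : Commute (of X v h) (wordProd X l) := by
  induction l with
  | nil => simp
  | cons a l ih =>
    rw [wordProd_cons]
    exact (commute_of (hl _ List.mem_cons_self) _ _).mul_right
      (ih fun b hb => hl b (List.mem_cons_of_mem _ hb))

/-- A word of minimal length among those representing the same element is reduced. -/
theorem isReduced_of_minimal (l : List (Σ v, H v))
    (hl : ∀ m, wordProd X m = wordProd X l → l.length ≤ m.length) : IsReduced X l := by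
  constructor
  · intro a ha h1
    obtain ⟨p, q, rfl⟩ := List.append_of_mem ha
    have := hl (p ++ q) (by simp [h1])
    simp at this
  · intro s₁ v s₂ s₃ hs
    by_contra! hcon
    obtain ⟨l₁, m₁, rfl, rfl, h₁⟩ := List.map_eq_append_iff.1 hs
    obtain ⟨a, m₂, rfl, ha, h₂⟩ := List.map_eq_cons_iff.1 h₁
    obtain ⟨l₂, m₃, rfl, rfl, h₃⟩ := List.map_eq_append_iff.1 h₂
    obtain ⟨b, l₃, rfl, hb, rfl⟩ := List.map_eq_cons_iff.1 h₃
    obtain ⟨va, a⟩ := a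
    obtain ⟨vb, b⟩ := b
    obtain rfl : va = v := ha
    obtain rfl : vb = va := hb
    -- If no letter between `a` and `b` blocks, `b` moves left through the link letters `m` and
    -- merges with `a * h`, which shortens the word.
    obtain ⟨h, m, hlen, hadj, heq⟩ := exists_of_mul_wordProd_eq (X := X) vb l₂ fun c hc => by
      by_contra! hc'
      exact hc'.2 (hcon _ (List.mem_map_of_mem hc) hc'.1)
    have hc := commute_of_wordProd vb b m hadj
    have := hl (l₁ ++ ⟨vb, a * h * b⟩ :: (m ++ l₃)) (by
      simp only [wordProd_append, wordProd_cons, heq, map_mul]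
      simp only [mul_assoc]
      rw [← mul_assoc (of X vb b), hc.eq, mul_assoc (wordProd X m)])
    simp at this
    omega

theorem exists_isReduced (x : GraphProduct H X) : ∃ l, IsReduced X l ∧ wordProd X l = x := by
  have hne : {l | wordProd X l = x}.Nonempty := exists_wordProd_eq x
  obtain ⟨l, hl, hmin⟩ := exists_minimalFor_of_wellFoundedLT
    (fun l => wordProd X l = x) List.length hne
  refine ⟨l, isReduced_of_minimal l fun m hm => ?_, hl⟩
  by_contra! hlt
  exact absurd (hmin (hm.trans hl) hlt.le) (by omega)

/-! ### Walls and coordinates -/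

variable (X H) in
/-- The subgroup generated by the vertex groups of the star of `v`. -/
def star (v : V) : Subgroup (GraphProduct H X) :=
  ⨆ w : {w // w = v ∨ X.Adj v w}, (of X w.1).range

theorem of_mem_star {v w : V} (hw : w = v ∨ X.Adj v w) (h : H w) : of X w h ∈ star X H v :=
  (le_iSup (fun w : {w // w = v ∨ X.Adj v w} => (of (H := H) X w.1).range) ⟨w, hw⟩) ⟨h, rfl⟩

open Classical in
variable (X H) in
/-- The retraction of the graph product to the star of `v`. -/
noncomputable def retract (v : V) : GraphProduct H X →* GraphProduct H X :=
  lift (fun w => if w = v ∨ X.Adj v w then of X w else 1) <| by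
    intro w w' hww' h k
    split_ifs
    · exact commute_of hww' h k
    all_goals simp

open Classical in
theorem retract_of (v w : V) (h : H w) :
    retract X H v (of X w h) = if w = v ∨ X.Adj v w then of X w h else 1 := by
  rw [retract, lift_of]
  split_ifs <;> rfl

theorem retract_of_mem {v : V} {x : GraphProduct H X} (hx : x ∈ star X H v) :
    retract X H v x = x := by
  have : star X H v ≤ (retract X H v).eqLocus (MonoidHom.id _) := by
    refine iSup_le ?_
    rintro ⟨w, hw⟩ _ ⟨h, rfl⟩
    change retract X H v (of X w h) = of X w h
    rw [retract_of, if_pos hw]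
  exact this hx

open Classical in
theorem retract_wordProd (v : V) (l : List (Σ v, H v)) :
    retract X H v (wordProd X l) =
      wordProd X (l.filter fun a => a.1 = v ∨ X.Adj v a.1) := by
  induction l with
  | nil => simp
  | cons a l ih =>
    rw [wordProd_cons, map_mul, ih, retract_of, List.filter_cons]
    split_ifs with h1 h2 h2
    · simp
    · simp_all
    · simp_all
    · simp

variable (X H) in
/-- The walls of the graph product. -/
abbrev Wall : Type _ := Σ v, GraphProduct H X ⧸ star X H v

/-- The class of the wall between `x` and its translates by the vertex group of `v`. -/
def wallClass (v : V) (x : GraphProduct H X) : GraphProduct H X ⧸ star X H v :=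
  ((x⁻¹ : GraphProduct H X) : GraphProduct H X ⧸ star X H v)

/-- The wall between `x` and its translates by the vertex group of `v`. -/
abbrev wall (v : V) (x : GraphProduct H X) : Wall X H := ⟨v, wallClass v x⟩

theorem wallClass_eq_iff {v : V} {x y : GraphProduct H X} :
    wallClass v x = wallClass v y ↔ x * y⁻¹ ∈ star X H v := by
  simp [wallClass, QuotientGroup.eq]

theorem wallClass_mul (v : V) (x y : GraphProduct H X) :
    wallClass v (x * y) = y⁻¹ • wallClass v x := by
  simp only [wallClass, mul_inv_rev]
  rfl

/-- Makes both actions below well defined: a move at `v`, or at a neighbour of `v`, does not change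
which `v`-wall is faced next. -/
theorem wallClass_of_mul {v w : V} (hw : w = v ∨ X.Adj v w) (h : H w) (x : GraphProduct H X) :
    wallClass v (of X w h * x) = wallClass v x := by
  rw [wallClass_eq_iff, mul_inv_cancel_right]
  exact of_mem_star hw h

theorem wall_of_mul {v w : V} (hw : w = v ∨ X.Adj v w) (h : H w) (x : GraphProduct H X) :
    wall v (of X w h * x) = wall v x :=
  congrArg (Sigma.mk v) (wallClass_of_mul hw h x)

open Classical in
/-- Left multiplication of one coordinate by `h`. -/
noncomputable def mulCoord (v : V) (c : GraphProduct H X ⧸ star X H v) (h : H v)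
    (f : ∀ W : Wall X H, H W.1) : ∀ W : Wall X H, H W.1 :=
  Function.update f ⟨v, c⟩ (h * f ⟨v, c⟩)

@[simp]
theorem mulCoord_self (v : V) (c : GraphProduct H X ⧸ star X H v) (h : H v)
    (f : ∀ W : Wall X H, H W.1) : mulCoord v c h f ⟨v, c⟩ = h * f ⟨v, c⟩ :=
  by classical exact Function.update_self ..

theorem mulCoord_of_ne {v : V} {c : GraphProduct H X ⧸ star X H v} {W : Wall X H}
    (hW : W ≠ ⟨v, c⟩) (h : H v) (f : ∀ W : Wall X H, H W.1) : mulCoord v c h f W = f W :=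
  by classical exact Function.update_of_ne hW ..

@[simp]
theorem mulCoord_one (v : V) (c : GraphProduct H X ⧸ star X H v)
    (f : ∀ W : Wall X H, H W.1) : mulCoord v c 1 f = f := by
  simp [mulCoord]

theorem mulCoord_mul (v : V) (c : GraphProduct H X ⧸ star X H v) (h k : H v)
    (f : ∀ W : Wall X H, H W.1) :
    mulCoord v c (h * k) f = mulCoord v c h (mulCoord v c k f) := by
  simp [mulCoord, mul_assoc]

theorem mulCoord_comm {v w : V} (hvw : v ≠ w) (c : GraphProduct H X ⧸ star X H v)
    (d : GraphProduct H X ⧸ star X H w) (h : H v) (k : H w) (f : ∀ W : Wall X H, H W.1) :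
    mulCoord v c h (mulCoord w d k f) = mulCoord w d k (mulCoord v c h f) := by
  classical
  have hne : (⟨v, c⟩ : Wall X H) ≠ ⟨w, d⟩ := fun he => hvw (congrArg Sigma.fst he)
  rw [mulCoord, mulCoord_of_ne hne, mulCoord, mulCoord, mulCoord_of_ne hne.symm, mulCoord,
    Function.update_comm hne]

variable (X H) in
/-- The action of a vertex group on elements with coordinates: it changes the coordinate of the
wall that is crossed. -/
noncomputable def coordEnd (v : V) :
    H v →* Function.End (GraphProduct H X × (∀ W : Wall X H, H W.1)) where
  toFun h p := (of X v h * p.1, mulCoord v (wallClass v p.1) h p.2)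
  map_one' := by
    funext p
    simp [end_one_apply]
  map_mul' h k := by
    funext p
    change _ = (of X v h * (of X v k * p.1),
      mulCoord v (wallClass v (of X v k * p.1)) h (mulCoord v (wallClass v p.1) k p.2))
    rw [wallClass_of_mul (Or.inl rfl), map_mul, mul_assoc, mulCoord_mul]

theorem coordEnd_apply (v : V) (h : H v) (p : GraphProduct H X × (∀ W : Wall X H, H W.1)) :
    coordEnd X H v h p = (of X v h * p.1, mulCoord v (wallClass v p.1) h p.2) := rfl

variable (X H) in
/-- The action of the graph product on elements with coordinates. -/
noncomputable def coordHom :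
    GraphProduct H X →* Function.End (GraphProduct H X × (∀ W : Wall X H, H W.1)) :=
  lift (coordEnd X H) <| by
    intro v w hvw h k
    funext p
    simp only [end_mul_apply, coordEnd_apply]
    rw [wallClass_of_mul (Or.inr hvw), wallClass_of_mul (Or.inr hvw.symm), ← mul_assoc,
      ← mul_assoc, (commute_of hvw h k).eq, mulCoord_comm hvw.ne]

theorem coordHom_of (v : V) (h : H v) : coordHom X H (of X v h) = coordEnd X H v h :=
  lift_of ..

/-- The coordinates of an element with respect to all walls. -/
noncomputable def coord (x : GraphProduct H X) : ∀ W : Wall X H, H W.1 := (coordHom X H x (1, 1)).2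

theorem coordHom_fst (x : GraphProduct H X) (p) : (coordHom X H x p).1 = x * p.1 := by
  obtain ⟨l, rfl⟩ := exists_wordProd_eq x
  induction l with
  | nil => simp [end_one_apply]
  | cons a l ih =>
    rw [wordProd_cons, map_mul, end_mul_apply, mul_assoc, ← ih]
    rw [coordHom_of, coordEnd_apply]

@[simp]
theorem coord_one : coord (1 : GraphProduct H X) = 1 := by
  simp [coord, end_one_apply]

theorem coord_of_mul (v : V) (h : H v) (x : GraphProduct H X) :
    coord (of X v h * x) = mulCoord v (wallClass v x) h (coord x) := by
  have h1 := coordHom_fst x (1, 1)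
  rw [coord, map_mul, end_mul_apply, coordHom_of, coordEnd_apply, h1, mul_one]
  rfl

/-- Cocycle rule: a path to `x * y` runs first to `y`, then along a translate of a path to `x`, so
the walls crossed by the second piece are shifted by `y`. -/
theorem coord_mul (x y : GraphProduct H X) (v : V) (c : GraphProduct H X ⧸ star X H v) :
    coord (x * y) ⟨v, c⟩ = coord x ⟨v, y • c⟩ * coord y ⟨v, c⟩ := by
  obtain ⟨l, rfl⟩ := exists_wordProd_eq x
  induction l with
  | nil => simp
  | cons a l ih =>
    obtain ⟨w, h⟩ := a
    rw [wordProd_cons, mul_assoc, coord_of_mul, coord_of_mul, wallClass_mul]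
    by_cases hvw : v = w
    · subst hvw
      by_cases hc : y • c = wallClass v (wordProd X l)
      · rw [← hc, inv_smul_smul, mulCoord_self, mulCoord_self, ih, mul_assoc]
      · rw [mulCoord_of_ne, mulCoord_of_ne, ih]
        · simpa using hc
        · simpa [eq_inv_smul_iff] using hc
    · rw [mulCoord_of_ne, mulCoord_of_ne, ih]
      all_goals exact fun he => hvw (congrArg Sigma.fst he)

variable (X H) in
/-- The walls that separate `x` from `1`. -/
def coordSupport (x : GraphProduct H X) : Set (Wall X H) := {W | coord x W ≠ 1}

theorem coordSupport_of_mul_subset (v : V) (h : H v) (x : GraphProduct H X) :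
    coordSupport X H (of X v h * x) ⊆ insert (wall v x) (coordSupport X H x) := by
  classical
  intro W hW
  by_cases hWv : W = wall v x
  · exact Or.inl hWv
  · right
    simpa [coordSupport, coord_of_mul, mulCoord_of_ne hWv] using hW

theorem finite_coordSupport_wordProd (l : List (Σ v, H v)) :
    (coordSupport X H (wordProd X l)).Finite ∧
      (coordSupport X H (wordProd X l)).ncard ≤ l.length := by
  induction l with
  | nil => simp [coordSupport]
  | cons a l ih =>
    rw [wordProd_cons]
    have hfin := ih.1.insert (wall a.1 (wordProd X l))
    have hsub := coordSupport_of_mul_subset a.1 a.2 (wordProd X l)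
    refine ⟨hfin.subset hsub, (Set.ncard_le_ncard hsub hfin).trans ?_⟩
    exact (Set.ncard_insert_le _ _).trans (by simpa using ih.2)

theorem exists_wall_eq_of_mem_coordSupport (l : List (Σ v, H v)) {W : Wall X H}
    (hW : W ∈ coordSupport X H (wordProd X l)) :
    ∃ l₁ a l₂, l = l₁ ++ a :: l₂ ∧ W = wall a.1 (wordProd X l₂) := by
  induction l with
  | nil => simp [coordSupport] at hW
  | cons a l ih =>
    rw [wordProd_cons] at hW
    rcases coordSupport_of_mul_subset _ _ _ hW with rfl | hW
    · exact ⟨[], a, l, rfl, rfl⟩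
    · obtain ⟨l₁, b, l₂, rfl, rfl⟩ := ih hW
      exact ⟨a :: l₁, b, l₂, rfl, rfl⟩

/-- The number of walls that separate a reduced word from `1` is its length. -/
theorem ncard_coordSupport_wordProd (n : ℕ) (l : List (Σ v, H v)) (hn : l.length = n)
    (hl : IsReduced X l) : (coordSupport X H (wordProd X l)).ncard = l.length := by
  classical
  induction n using Nat.strong_induction_on generalizing l with
  | _ n ih =>
  cases l with
  | nil => simp [coordSupport]
  | cons a t =>
    have htlen : t.length < n := by simp [← hn]
    have ht := ih _ htlen t rfl (hl.of_infix (List.infix_cons (List.infix_refl t)))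
    -- A second crossing of the same wall would put the segment `l₂` between the two crossings in
    -- the star of `v`. The retraction then fixes its product but deletes a letter of `l₂`, so fewer
    -- than `l₂.length` walls separate it from `1`, against the induction hypothesis.
    have hW : wall a.1 (wordProd X t) ∉ coordSupport X H (wordProd X t) := by
      intro hW
      obtain ⟨l₂, b, l₃, rfl, hab⟩ := exists_wall_eq_of_mem_coordSupport t hW
      obtain ⟨v, h⟩ := a
      obtain ⟨w, k⟩ := b
      obtain rfl : v = w := congrArg Sigma.fst hab
      have hab := wallClass_eq_iff.1 (eq_of_heq (Sigma.mk.inj hab).2)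
      have hmem : wordProd X l₂ ∈ star X H v := by
        have := Subgroup.mul_mem _ hab (Subgroup.inv_mem _ (of_mem_star (Or.inl rfl) k))
        simpa [mul_assoc] using this
      have hl₂ := ih l₂.length (by simp at htlen; omega) l₂ rfl
        (hl.of_infix ⟨[⟨v, h⟩], ⟨v, k⟩ :: l₃, by simp⟩)
      obtain ⟨w, hw, hwv, hadj⟩ := hl.2 [] v (l₂.map Sigma.fst) (l₃.map Sigma.fst) (by simp)
      obtain ⟨c, hc, rfl⟩ := List.mem_map.1 hw
      have hlt : (l₂.filter fun a => a.1 = v ∨ X.Adj v a.1).length < l₂.length := by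
        refine List.length_filter_lt_length_iff_exists.2 ⟨c, hc, by simp [hwv, hadj]⟩
      have hle := (finite_coordSupport_wordProd (X := X)
        (l₂.filter fun a => a.1 = v ∨ X.Adj v a.1)).2
      rw [← retract_wordProd, retract_of_mem hmem, hl₂] at hle
      omega
    have hins : coordSupport X H (wordProd X (a :: t)) =
        insert (wall a.1 (wordProd X t)) (coordSupport X H (wordProd X t)) := by
      rw [wordProd_cons]
      refine (coordSupport_of_mul_subset _ _ _).antisymm (Set.insert_subset ?_ ?_)
      · have h1 : coord (wordProd X t) (wall a.1 (wordProd X t)) = 1 := by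
          simpa [coordSupport] using hW
        have h2 := hl.1 a List.mem_cons_self
        simp only [coordSupport, Set.mem_ofPred_eq, coord_of_mul, mulCoord_self, h1]
        simpa using h2
      · intro W hW'
        have hne : W ≠ wall a.1 (wordProd X t) := fun he => hW (he ▸ hW')
        simpa [coordSupport, coord_of_mul, mulCoord_of_ne hne] using hW'
    rw [hins, Set.ncard_insert_of_notMem hW (finite_coordSupport_wordProd t).1, ht]
    simp

/-- The normal form theorem: a nonempty reduced word represents a nontrivial element. -/
theorem IsReduced.wordProd_ne_one {l : List (Σ v, H v)} (hl : IsReduced X l) (hne : l ≠ []) :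
    wordProd X l ≠ 1 := by
  intro h1
  have h2 := ncard_coordSupport_wordProd _ l rfl hl
  rw [h1] at h2
  simp only [coordSupport, coord_one, Pi.one_apply, ne_eq, not_true_eq_false,
    Set.ofPred_false, Set.ncard_empty] at h2
  exact hne (List.length_eq_zero_iff.1 h2.symm)

theorem eq_one_of_coord_eq_one {x : GraphProduct H X} (hx : ∀ W, coord x W = 1) : x = 1 := by
  obtain ⟨l, hl, rfl⟩ := exists_isReduced x
  have h2 := ncard_coordSupport_wordProd _ l rfl hl
  simp only [coordSupport, hx, ne_eq, not_true_eq_false, Set.ofPred_false, Set.ncard_empty] at h2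
  rw [List.length_eq_zero_iff.1 h2.symm, wordProd_nil]

theorem coord_injective :
    Function.Injective (coord : GraphProduct H X → ∀ W : Wall X H, H W.1) := by
  intro x y hxy
  rw [← mul_inv_eq_one]
  refine eq_one_of_coord_eq_one fun ⟨v, c⟩ => ?_
  -- The cocycle rule at this coset cancels the equal coordinates of `x` and `y`, leaving those of
  -- `x * y⁻¹` trivial.
  have h1 := coord_mul (x * y⁻¹) y v (y⁻¹ • c)
  rw [inv_mul_cancel_right, smul_inv_smul, hxy] at h1
  exact mul_eq_right.1 h1.symm

/-! ### Truncated actions -/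

open Classical in
/-- The action of a vertex group on the graph product that crosses only the walls in `T`. -/
noncomputable def truncEnd (T : Set (Wall X H)) (v : V) : H v →* Function.End (GraphProduct H X) where
  toFun h x := if wall v x ∈ T then of X v h * x else x
  map_one' := by
    funext x
    simp [end_one_apply]
  map_mul' h k := by
    funext x
    change _ = if wall v (if wall v x ∈ T then _ else _) ∈ T then _ else _
    by_cases hx : wall v x ∈ T <;> simp [hx, wall_of_mul, mul_assoc]

open Classical in
theorem truncEnd_apply (T : Set (Wall X H)) (v : V) (h : H v) (x : GraphProduct H X) :
    truncEnd T v h x = if wall v x ∈ T then of X v h * x else x := rfl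

/-- The action of the graph product on itself that crosses only the walls in `T`. -/
noncomputable def truncHom (T : Set (Wall X H)) : GraphProduct H X →* Function.End (GraphProduct H X) :=
  lift (truncEnd T) <| by
    intro v w hvw h k
    funext x
    have hv (h : H v) (x : GraphProduct H X) := wall_of_mul (Or.inr hvw.symm) h x
    have hw (k : H w) (x : GraphProduct H X) := wall_of_mul (Or.inr hvw) k x
    by_cases h1 : wall v x ∈ T <;> by_cases h2 : wall w x ∈ T <;>
      simp [end_mul_apply, truncEnd_apply, h1, h2, hv, hw]
    rw [← mul_assoc, (commute_of hvw h k).eq, mul_assoc]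

theorem truncHom_of (T : Set (Wall X H)) (v : V) (h : H v) :
    truncHom T (of X v h) = truncEnd T v h :=
  lift_of ..

open Classical in
theorem truncHom_of_mul (T : Set (Wall X H)) (v : V) (h : H v) (x y : GraphProduct H X) :
    truncHom T (of X v h * x) y =
      if wall v (truncHom T x y) ∈ T then of X v h * truncHom T x y else truncHom T x y := by
  rw [map_mul, end_mul_apply, truncHom_of, truncEnd_apply]

theorem coord_truncHom (T : Set (Wall X H)) (x : GraphProduct H X) {W : Wall X H}
    (hW : W ∉ T) : coord (truncHom T x 1) W = 1 := by
  classical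
  obtain ⟨l, rfl⟩ := exists_wordProd_eq x
  induction l with
  | nil => simp [end_one_apply]
  | cons a l ih =>
    rw [wordProd_cons, truncHom_of_mul]
    split_ifs with h1
    · rw [coord_of_mul, mulCoord_of_ne (fun he => hW (by rwa [he]))]
      exact ih
    · exact ih

/-- Orbit points have trivial coordinates off `T`, hence are determined by finitely many coordinates
in finite groups. -/
theorem finite_range_truncHom [∀ v, Finite (H v)] {T : Set (Wall X H)} (hT : T.Finite) :
    (Set.range fun x => truncHom T x 1).Finite := by
  have := hT.to_subtype
  refine Set.Finite.of_injOn (f := fun x (W : T) => coord x W.1) (t := Set.univ)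
    (fun _ _ => Set.mem_univ _) ?_ Set.finite_univ
  rintro _ ⟨x, rfl⟩ _ ⟨y, rfl⟩ hxy
  refine coord_injective (funext fun W => ?_)
  by_cases hW : W ∈ T
  · exact congrFun hxy ⟨W, hW⟩
  · simp only [coord_truncHom T _ hW]

/-- `T` collects the walls met while the word is read from right to left; with these available the
truncation is never felt. -/
theorem exists_finite_walls (l : List (Σ v, H v)) :
    ∃ T : Set (Wall X H), T.Finite ∧
      ∀ T', T ⊆ T' → truncHom T' (wordProd X l) 1 = wordProd X l := by
  classical
  induction l with
  | nil => exact ⟨∅, Set.finite_empty, by simp [end_one_apply]⟩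
  | cons a l ih =>
    obtain ⟨T, hT, h⟩ := ih
    refine ⟨insert (wall a.1 (wordProd X l)) T, hT.insert _, fun T' hT' => ?_⟩
    rw [wordProd_cons, truncHom_of_mul, h T' ((Set.subset_insert _ _).trans hT'),
      if_pos (hT' (Set.mem_insert _ _))]

/-- A graph product of finite groups is LEF. -/
theorem isLEF_of_finite [∀ v, Finite (H v)] : IsLEF (GraphProduct H X) := by
  intro A hA
  have hex (x : GraphProduct H X) : ∃ T : Set (Wall X H), T.Finite ∧
      ∀ T', T ⊆ T' → truncHom T' x 1 = x := by
    obtain ⟨l, rfl⟩ := exists_wordProd_eq x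
    exact exists_finite_walls l
  choose T hT hTx using hex
  have hU : (⋃ x ∈ A, T x).Finite := hA.biUnion fun x _ => hT x
  generalize hUdef : (⋃ x ∈ A, T x) = U at hU
  have hAU (x) (hx : x ∈ A) : truncHom U x 1 = x :=
    hTx x U (hUdef ▸ Set.subset_biUnion_of_mem (u := T) hx)
  let O : Set (GraphProduct H X) := Set.range fun x => truncHom U x 1
  have hO : Finite O := finite_range_truncHom hU
  have h1 : (1 : GraphProduct H X) ∈ O := ⟨1, by simp [end_one_apply]⟩
  let ρ : GraphProduct H X →* Function.End O :=
    { toFun := fun x y => ⟨truncHom U x y.1, by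
        obtain ⟨_, z, rfl⟩ := y
        exact ⟨x * z, by simp [end_mul_apply]⟩⟩
      map_one' := by
        funext y
        simp [end_one_apply]
      map_mul' := fun x y => by
        funext z
        exact Subtype.ext (congrFun (map_mul (truncHom U) x y) z.1) }
  obtain ⟨n, ⟨e⟩⟩ := Finite.exists_equiv_fin O
  -- The source is a group, so the action by self-maps of the orbit is by permutations.
  let τ : GraphProduct H X →* Equiv.Perm (Fin n) :=
    e.permCongrHom.toMonoidHom.comp
      ((Equiv.Perm.equivUnitsEnd (α := O)).symm.toMonoidHom.comp ρ.toHomUnits)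
  refine ⟨Equiv.Perm (Fin n), inferInstance, inferInstance, fun a => τ a, ?_, ?_⟩
  · rintro ⟨a, ha⟩ ⟨b, hb⟩ hab
    have h2 : ρ a = ρ b := by
      have := (Equiv.Perm.equivUnitsEnd (α := O)).symm.injective (e.permCongrHom.injective hab)
      exact congrArg Units.val this
    have h3 := congrArg Subtype.val (congrFun h2 ⟨1, h1⟩)
    exact Subtype.ext ((hAU a ha).symm.trans (h3.trans (hAU b hb)))
  · intro g h _
    exact map_mul τ _ _

end

end GraphProduct

/-! ### Ultraproducts and reduction to finite vertex groups -/

/-- The normal subgroup of sequences that are eventually trivial along a filter. -/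
def eventuallyOne {I : Type*} (L : Filter I) (G : I → Type*) [∀ i, Group (G i)] :
    Subgroup (∀ i, G i) where
  carrier := {g | ∀ᶠ i in L, g i = 1}
  one_mem' := Filter.Eventually.of_forall fun _ => rfl
  mul_mem' {g h} hg hh := by
    filter_upwards [hg, hh] with i h1 h2
    simp [h1, h2]
  inv_mem' {g} hg := by
    filter_upwards [hg] with i h1
    simp [h1]

theorem mem_eventuallyOne {I : Type*} {L : Filter I} {G : I → Type*} [∀ i, Group (G i)]
    {g : ∀ i, G i} : g ∈ eventuallyOne L G ↔ ∀ᶠ i in L, g i = 1 := Iff.rfl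

instance {I : Type*} (L : Filter I) (G : I → Type*) [∀ i, Group (G i)] :
    (eventuallyOne L G).Normal where
  conj_mem g hg h := by
    filter_upwards [mem_eventuallyOne.1 hg] with i h1
    simp [h1]

/-- A group that embeds into an ultraproduct of LEF groups is LEF. -/
theorem IsLEF.of_ultraproduct {Γ I : Type*} [Group Γ] (L : Ultrafilter I) {G : I → Type*}
    [∀ i, Group (G i)] (hG : ∀ i, IsLEF (G i))
    (Φ : Γ →* (∀ i, G i) ⧸ eventuallyOne (L : Filter I) G) (hΦ : Function.Injective Φ) :
    IsLEF Γ := by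
  intro A hA
  choose ψ hψ using fun x : Γ => QuotientGroup.mk_surjective (Φ x)
  have hmul (a b : Γ) : ∀ᶠ i in L, ψ (a * b) i = ψ a i * ψ b i := by
    have h1 : ((ψ (a * b) : ∀ i, G i) : (∀ i, G i) ⧸ eventuallyOne (L : Filter I) G) =
        ((ψ a * ψ b : ∀ i, G i)) := by
      rw [hψ, map_mul, QuotientGroup.mk_mul, hψ, hψ]
    filter_upwards [mem_eventuallyOne.1 (QuotientGroup.eq.1 h1)] with i hi
    exact inv_mul_eq_one.1 hi
  have hne (a b : Γ) (hab : a ≠ b) : ∀ᶠ i in L, ψ a i ≠ ψ b i := by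
    rw [Ultrafilter.eventually_not]
    intro h
    refine hab (hΦ ?_)
    rw [← hψ a, ← hψ b, QuotientGroup.eq, mem_eventuallyOne]
    filter_upwards [h] with i hi
    simp [hi]
  have h1 : ∀ᶠ i in L, ∀ a ∈ A, ∀ b ∈ A, ψ (a * b) i = ψ a i * ψ b i :=
    (Filter.eventually_all_finite hA).2 fun a _ =>
      (Filter.eventually_all_finite hA).2 fun b _ => hmul a b
  have h2 : ∀ᶠ i in L, ∀ a ∈ A, ∀ b ∈ A, a ≠ b → ψ a i ≠ ψ b i :=
    (Filter.eventually_all_finite hA).2 fun a _ =>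
      (Filter.eventually_all_finite hA).2 fun b _ => Filter.eventually_imp_distrib_left.2 (hne a b)
  obtain ⟨i, hi1, hi2⟩ := (h1.and h2).exists
  obtain ⟨Q, _, _, φ, hφ, hφm⟩ := hG i ((fun a => ψ a i) '' A) (hA.image _)
  refine ⟨Q, inferInstance, inferInstance,
    fun a => φ ⟨ψ a.1 i, Set.mem_image_of_mem _ a.2⟩, ?_, ?_⟩
  · rintro ⟨a, ha⟩ ⟨b, hb⟩ hab
    by_contra hne
    exact hi2 a ha b hb (fun h => hne (Subtype.ext h)) (congrArg Subtype.val (hφ hab))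
  · rintro ⟨a, ha⟩ ⟨b, hb⟩ hab
    have h3 := hi1 a ha b hb
    have h4 := hφm ⟨ψ a i, Set.mem_image_of_mem _ ha⟩ ⟨ψ b i, Set.mem_image_of_mem _ hb⟩
      (h3 ▸ Set.mem_image_of_mem (fun a => ψ a i) hab)
    rw [← h4]
    exact congrArg φ (Subtype.ext h3)

theorem IsLEF.exists_total {Γ : Type*} [Group Γ] (hΓ : IsLEF Γ) {A : Set Γ} (hA : A.Finite) :
    ∃ (Q : Type) (_ : Group Q) (_ : Finite Q) (φ : Γ → Q), Set.InjOn φ A ∧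
      ∀ g ∈ A, ∀ h ∈ A, g * h ∈ A → φ (g * h) = φ g * φ h := by
  classical
  obtain ⟨Q, _, _, φ, hφ, hφm⟩ := hΓ A hA
  refine ⟨Q, inferInstance, inferInstance, fun g => if hg : g ∈ A then φ ⟨g, hg⟩ else 1, ?_, ?_⟩
  · intro g hg h hh hgh
    simp only [hg, hh, dif_pos] at hgh
    exact congrArg Subtype.val (hφ hgh)
  · intro g hg h hh hgh
    simp only [hg, hh, hgh, dif_pos]
    exact hφm ⟨g, hg⟩ ⟨h, hh⟩ hgh

namespace GraphProduct

/-- If, for each vertex `v`, the maps `φ i v` are eventually multiplicative and eventually do not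
kill a given nontrivial element, then the graph product embeds into the ultraproduct of the graph
products of their targets. -/
theorem exists_injective_ultraproduct {V I : Type*} (X : SimpleGraph V)
    {H : V → Type*} [∀ v, Group (H v)] (L : Ultrafilter I) {Q : I → V → Type*}
    [∀ i v, Group (Q i v)] (φ : ∀ i v, H v → Q i v)
    (hmul : ∀ v g h, ∀ᶠ i in L, φ i v (g * h) = φ i v g * φ i v h)
    (hne : ∀ v g, g ≠ 1 → ∀ᶠ i in L, φ i v g ≠ 1) :
    ∃ Φ : GraphProduct H X →*
        (∀ i, GraphProduct (Q i) X) ⧸ eventuallyOne (L : Filter I) fun i => GraphProduct (Q i) X,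
      Function.Injective Φ := by
  let π := QuotientGroup.mk' (eventuallyOne (L : Filter I) fun i => GraphProduct (Q i) X)
  let f (v : V) : H v →* (∀ i, GraphProduct (Q i) X) ⧸
      eventuallyOne (L : Filter I) fun i => GraphProduct (Q i) X :=
    MonoidHom.mk' (fun h => π fun i => of X v (φ i v h)) <| by
      intro g h
      rw [← map_mul, QuotientGroup.mk'_apply, QuotientGroup.mk'_apply, QuotientGroup.eq,
        mem_eventuallyOne]
      filter_upwards [hmul v g h] with i hi
      simp [hi]
  have hf (v w : V) (hvw : X.Adj v w) (h : H v) (k : H w) : Commute (f v h) (f w k) := by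
    change π _ * π _ = π _ * π _
    rw [← map_mul, ← map_mul]
    exact congrArg _ (funext fun i => (commute_of hvw _ _).eq)
  let mapWord (i : I) (l : List (Σ v, H v)) : List (Σ v, Q i v) :=
    l.map fun a => ⟨a.1, φ i a.1 a.2⟩
  have hword (l : List (Σ v, H v)) : lift f hf (wordProd X l) = π fun i => wordProd X (mapWord i l) := by
    induction l with
    | nil => exact (map_one π).symm
    | cons a l ih =>
      rw [wordProd_cons, map_mul, ih, lift_of]
      change π _ * π _ = _
      rw [← map_mul]
      exact congrArg _ (funext fun i => (wordProd_cons (⟨a.1, φ i a.1 a.2⟩ : Σ v, Q i v) (mapWord i l)).symm)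
  refine ⟨lift f hf, (injective_iff_map_eq_one _).2 fun x hx => ?_⟩
  obtain ⟨l, hl, rfl⟩ := exists_isReduced x
  by_contra hne1
  have hlne : l ≠ [] := by
    rintro rfl
    exact hne1 rfl
  rw [hword, QuotientGroup.mk'_apply, QuotientGroup.eq_one_iff, mem_eventuallyOne] at hx
  have h1 : ∀ᶠ i in L, ∀ a ∈ {a | a ∈ l}, φ i a.1 a.2 ≠ 1 :=
    (Filter.eventually_all_finite (List.finite_toSet l)).2 fun a ha => hne _ _ (hl.1 a ha)
  obtain ⟨i, hi, hi1⟩ := (hx.and h1).exists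
  -- Being reduced depends only on the vertex sequence and on the letters being nontrivial; both
  -- persist at this index.
  refine IsReduced.wordProd_ne_one (l := mapWord i l) ⟨?_, ?_⟩ (by simpa [mapWord] using hlne) hi
  · intro b hb
    obtain ⟨a, ha, rfl⟩ := List.mem_map.1 hb
    exact hi1 a ha
  · have : (mapWord i l).map Sigma.fst = l.map Sigma.fst := by
      simp [mapWord, Function.comp_def]
    rw [this]
    exact hl.2

end GraphProduct

theorem mainTheorem8 {V : Type*} (X : SimpleGraph V) (H : V → Type*) [∀ v, Group (H v)]
    (hH : ∀ v, IsLEF (H v)) : IsLEF (GraphProduct H X) := by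
  have hfin (i : Finset (Σ v, H v)) (v : V) : {h : H v | (⟨v, h⟩ : Σ v, H v) ∈ i}.Finite :=
    i.finite_toSet.preimage sigma_mk_injective.injOn
  choose Q hQ hQfin φ hφ hφm using fun i v => (hH v).exists_total (hfin i v)
  -- Refining `atTop` makes every fixed letter eventually belong to `i`, so each single
  -- multiplicativity or injectivity condition eventually holds.
  let L : Ultrafilter (Finset (Σ v, H v)) := Ultrafilter.of Filter.atTop
  have hmem (v : V) (h : H v) : ∀ᶠ i : Finset (Σ v, H v) in L, (⟨v, h⟩ : Σ v, H v) ∈ i := by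
    refine Filter.Eventually.filter_mono (Ultrafilter.of_le _) ?_
    filter_upwards [Filter.eventually_ge_atTop {⟨v, h⟩}] with i hi
    exact Finset.singleton_subset_iff.1 hi
  have hmul (v : V) (g h : H v) : ∀ᶠ i in L, φ i v (g * h) = φ i v g * φ i v h := by
    filter_upwards [hmem v g, hmem v h, hmem v (g * h)] with i h1 h2 h3
    exact hφm i v g h1 h h2 h3
  obtain ⟨Φ, hΦ⟩ := GraphProduct.exists_injective_ultraproduct X L φ hmul fun v g hg => by
    -- Multiplicativity at `1 * 1` forces `φ i v 1 = 1`; injectivity on the slice then keeps `g`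
    -- nontrivial.
    filter_upwards [hmem v g, hmem v 1, hmul v 1 1] with i h1 h2 h3 h4
    rw [mul_one, eq_comm, mul_eq_left] at h3
    exact hg (hφ i v h1 h2 (h4.trans h3.symm))
  exact IsLEF.of_ultraproduct L (fun i => GraphProduct.isLEF_of_finite) Φ hΦ
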